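/- For a positive integer $n$ let $a(n)$ and $b(n)$ be the numbers of pairs $(k,l)\in\mathbb{Z}^2$ with $k^2+15l^2=n$ and with $3k^2+5l^2=n$, respectively. Write the prime factorization of $n$ as $$n = 2^a 3^b 5^c \prod_{i=1}^r p_i^{v_i} \prod_{j=1}^s q_j^{w_j},$$ where $a,b,c,r,s\ge 0$, the $p_i$ are distinct primes with $p_i \equiv 1, 2, 4$ or $8 \pmod{15}$ and $p_i\neq 2$, and the $q_j$ are distinct primes with $q_j \equiv 7, 11, 13$ or $14 \pmod{15}$. Let $t$ be the number of odd prime factors of $n$, counted with multiplicity, that are congruent to $2$ or $8$ modulo $15$. Then $$a(n) = |a-1| \left(1 + (-1)^{a+b+c+t}\right) \prod_{i=1}^r (1+v_i) \prod_{j=1}^s \frac{1+(-1)^{w_j}}{2}$$ and $$b(n) = |a-1| \left(1 - (-1)^{a+b+c+t}\right) \prod_{i=1}^r (1+v_i) \prod_{j=1}^s \frac{1+(-1)^{w_j}}{2}.$$ -/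

import Mathlib

/-- The representations of `n` by the binary quadratic form `α k² + β l²`: all ordered pairs of
integers `(k, l)`, with signs and order counted, at which the form takes the value `n`. -/
def diagReps (α β n : ℕ) : Set (ℤ × ℤ) :=
  {x | (α : ℤ) * x.1 ^ 2 + (β : ℤ) * x.2 ^ 2 = (n : ℤ)}

/-- For positive coefficients there are only finitely many representations, so that counting them
with `Set.ncard` is meaningful. -/
theorem diagReps_finite {α β : ℕ} (hα : 0 < α) (hβ : 0 < β) (n : ℕ) :
    (diagReps α β n).Finite := by
  apply ((Set.finite_Icc (-(n : ℤ)) n).prod (Set.finite_Icc (-(n : ℤ)) n)).subset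
  rintro ⟨k, l⟩ h
  have hα' : (1 : ℤ) ≤ α := by exact_mod_cast hα
  have hβ' : (1 : ℤ) ≤ β := by exact_mod_cast hβ
  have h' : (α : ℤ) * k ^ 2 + (β : ℤ) * l ^ 2 = (n : ℤ) := h
  have hk : k ^ 2 ≤ n := by nlinarith [sq_nonneg k, sq_nonneg l]
  have hl : l ^ 2 ≤ n := by nlinarith [sq_nonneg k, sq_nonneg l]
  have key : ∀ m : ℤ, m ^ 2 ≤ n → -(n : ℤ) ≤ m ∧ m ≤ n := fun m hm =>
    abs_le.mp (by
      have h1 : |m| ≤ |m| ^ 2 := Int.le_self_sq _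
      rw [sq_abs] at h1
      exact h1.trans hm)
  exact ⟨key k hk, key l hl⟩

/-- The number of representations of `n` by the form `α k² + β l²`. -/
noncomputable def numDiagReps (α β n : ℕ) : ℕ := (diagReps α β n).ncard

/-- The number of odd prime factors of `n`, counted with multiplicity, that are congruent to
`2` or `8` modulo `15`. -/
def oddPrimeFactorCount (n : ℕ) : ℕ :=
  n.primeFactorsList.countP fun p => Odd p ∧ (p % 15 = 2 ∨ p % 15 = 8)

/-! Write N(n) for the number of representations by x² + 15y². The substitution x = 3k turns
representations of 3n by this form into those of n by 3k² + 5l², so both counts are values of N.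
Since N(5n) = N(3n) and N(9n) = N(n), the prime 3 acts as a switch between the two forms.

The other primes are removed one at a time. An inert q divides both coordinates, so it contributes
only through q². For a split p, some u² + 15v² equals 3^δ p with δ = `genus p` (Thue's lemma and
squares mod 5); composing with u ± v√-15 and using inclusion-exclusion (`numDiagReps_add_ncard`)
gives N(p²m) + N(m) = 2N(p·3^δ m). Up to the switch the second differences in the exponent vanish,
whence the factor 1 + v. The same argument with 3 + √-15 handles 2. What remains is N(3^j) = 1 +
(-1)^j. -/

/-! ### Transport of representations; the primes 3 and 5 -/

theorem mem_diagReps {α β n : ℕ} {x : ℤ × ℤ} :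
    x ∈ diagReps α β n ↔ (α : ℤ) * x.1 ^ 2 + (β : ℤ) * x.2 ^ 2 = (n : ℤ) := Iff.rfl

theorem mem_diagReps_one_fifteen {n : ℕ} {x : ℤ × ℤ} :
    x ∈ diagReps 1 15 n ↔ x.1 ^ 2 + 15 * x.2 ^ 2 = (n : ℤ) := by
  simp [mem_diagReps]

theorem mem_diagReps_three_five {n : ℕ} {x : ℤ × ℤ} :
    x ∈ diagReps 3 5 n ↔ 3 * x.1 ^ 2 + 5 * x.2 ^ 2 = (n : ℤ) := by
  simp [mem_diagReps]

theorem finite_diagReps_one_fifteen (n : ℕ) : (diagReps 1 15 n).Finite :=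
  diagReps_finite (by norm_num) (by norm_num) n

/-- Two forms represent two numbers equally often if an injective map matches the
representations. -/
theorem numDiagReps_eq_of_image {α β n α' β' n' : ℕ} (f : ℤ × ℤ → ℤ × ℤ)
    (hf : Function.Injective f) (h : ∀ x, x ∈ diagReps α β n ↔ f x ∈ diagReps α' β' n')
    (hs : ∀ y ∈ diagReps α' β' n', ∃ x, f x = y) :
    numDiagReps α β n = numDiagReps α' β' n' := by
  have : f '' diagReps α β n = diagReps α' β' n' := by
    ext y
    constructor
    · rintro ⟨x, hx, rfl⟩
      exact (h x).1 hx
    · intro hy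
      obtain ⟨x, rfl⟩ := hs y hy
      exact ⟨x, (h x).2 hy, rfl⟩
  unfold numDiagReps
  rw [← this, Set.ncard_image_of_injective _ hf]

theorem numDiagReps_three_five (n : ℕ) : numDiagReps 3 5 n = numDiagReps 1 15 (3 * n) := by
  apply numDiagReps_eq_of_image (fun x => (3 * x.1, x.2))
  · rintro ⟨x, y⟩ ⟨z, w⟩ h
    simp only [Prod.mk.injEq] at h ⊢
    omega
  · intro x
    rw [mem_diagReps_one_fifteen, mem_diagReps_three_five]
    push_cast
    constructor <;> intro h <;> linarith
  · rintro ⟨x, y⟩ h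
    rw [mem_diagReps_one_fifteen] at h
    push_cast at h
    have : (3 : ℤ) ∣ x := by
      apply Int.prime_three.dvd_of_dvd_pow (n := 2)
      exact ⟨n - 5 * y ^ 2, by linarith⟩
    obtain ⟨x, rfl⟩ := this
    exact ⟨(x, y), rfl⟩

/-- Both sides count representations of n by 3k² + 5l²: multiplying the form by 5 instead of 3 only
swaps the roles of the coordinates. -/
theorem numDiagReps_five_mul (n : ℕ) : numDiagReps 1 15 (5 * n) = numDiagReps 1 15 (3 * n) := by
  rw [← numDiagReps_three_five]
  symm
  apply numDiagReps_eq_of_image (fun x => (5 * x.2, x.1))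
  · rintro ⟨x, y⟩ ⟨z, w⟩ h
    simp only [Prod.mk.injEq] at h ⊢
    omega
  · intro x
    rw [mem_diagReps_one_fifteen, mem_diagReps_three_five]
    push_cast
    constructor <;> intro h <;> linarith
  · rintro ⟨x, y⟩ h
    rw [mem_diagReps_one_fifteen] at h
    push_cast at h
    have : (5 : ℤ) ∣ x := by
      apply (Nat.prime_iff_prime_int.1 Nat.prime_five).dvd_of_dvd_pow (n := 2)
      exact ⟨n - 3 * y ^ 2, by push_cast; linarith⟩
    obtain ⟨x, rfl⟩ := this
    exact ⟨(y, x), rfl⟩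

/-- If all representations of `d² n` are divisible by `d`, then they correspond to those
of `n`. -/
theorem numDiagReps_sq_mul {d n : ℕ} (hd : 0 < d)
    (h : ∀ x y : ℤ, x ^ 2 + 15 * y ^ 2 = d ^ 2 * n → (d : ℤ) ∣ x ∧ (d : ℤ) ∣ y) :
    numDiagReps 1 15 (d ^ 2 * n) = numDiagReps 1 15 n := by
  have hd' : (d : ℤ) ≠ 0 := by positivity
  symm
  apply numDiagReps_eq_of_image (fun x => (d * x.1, d * x.2))
  · rintro ⟨x, y⟩ ⟨z, w⟩ h
    simp only [Prod.mk.injEq, mul_right_inj' hd'] at h ⊢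
    exact h
  · intro x
    rw [mem_diagReps_one_fifteen, mem_diagReps_one_fifteen]
    push_cast
    rw [← mul_right_inj' (pow_ne_zero 2 hd')]
    constructor <;> intro h <;> linarith
  · rintro ⟨x, y⟩ hxy
    rw [mem_diagReps_one_fifteen] at hxy
    push_cast at hxy
    obtain ⟨⟨x, rfl⟩, ⟨y, rfl⟩⟩ := h x y hxy
    exact ⟨(x, y), rfl⟩

theorem numDiagReps_nine_mul (n : ℕ) : numDiagReps 1 15 (9 * n) = numDiagReps 1 15 n := by
  apply numDiagReps_sq_mul (d := 3) (by norm_num)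
  intro x y h
  push_cast at h ⊢
  have hx : (3 : ℤ) ∣ x := by
    apply Int.prime_three.dvd_of_dvd_pow (n := 2)
    exact ⟨3 * n - 5 * y ^ 2, by linarith⟩
  refine ⟨hx, ?_⟩
  obtain ⟨x, rfl⟩ := hx
  apply Int.prime_three.dvd_of_dvd_pow (n := 2)
  exact ⟨x ^ 2 + 2 * y ^ 2 - n, by linarith⟩

theorem numDiagReps_three_pow_mul (k n : ℕ) :
    numDiagReps 1 15 (3 ^ (2 * k) * n) = numDiagReps 1 15 n := by
  induction k with
  | zero => simp
  | succ k ih =>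
    rw [← ih, ← numDiagReps_nine_mul (3 ^ (2 * k) * n)]
    congr 1
    ring

theorem numDiagReps_five_pow_mul (c n : ℕ) :
    numDiagReps 1 15 (5 ^ c * n) = numDiagReps 1 15 (3 ^ c * n) := by
  induction c generalizing n with
  | zero => simp
  | succ c ih =>
    rw [pow_succ', mul_assoc, numDiagReps_five_mul, mul_left_comm, ih]
    congr 1
    ring

theorem numDiagReps_one : numDiagReps 1 15 1 = 2 := by
  have : diagReps 1 15 1 = {((1 : ℤ), (0 : ℤ)), (-1, 0)} := by
    ext ⟨x, y⟩
    rw [mem_diagReps_one_fifteen]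
    simp only [Nat.cast_one, Set.mem_insert_iff, Prod.mk.injEq, Set.mem_singleton_iff]
    constructor
    · intro h
      have hy : y = 0 := by
        by_contra hy
        have : 0 < y ^ 2 := by positivity
        nlinarith [sq_nonneg x]
      subst hy
      have : x ^ 2 = 1 := by linarith
      rcases sq_eq_sq_iff_eq_or_eq_neg.1 (this.trans (one_pow 2).symm) with h | h <;> simp [h]
    · rintro (⟨rfl, rfl⟩ | ⟨rfl, rfl⟩) <;> norm_num
  unfold numDiagReps
  rw [this, Set.ncard_pair]
  simp

theorem numDiagReps_three : numDiagReps 1 15 3 = 0 := by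
  have : diagReps 1 15 3 = ∅ := by
    ext ⟨x, y⟩
    rw [mem_diagReps_one_fifteen]
    simp only [Nat.cast_ofNat, Set.mem_empty_iff_false, iff_false]
    intro h
    have h1 : -2 < x := by nlinarith [sq_nonneg y]
    have h2 : x < 2 := by nlinarith [sq_nonneg y]
    have h3 : -1 < y := by nlinarith [sq_nonneg x]
    have h4 : y < 1 := by nlinarith [sq_nonneg x]
    interval_cases x <;> interval_cases y <;> omega
  unfold numDiagReps
  rw [this, Set.ncard_empty]

theorem numDiagReps_three_pow (j : ℕ) : (numDiagReps 1 15 (3 ^ j) : ℚ) = 1 + (-1) ^ j := by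
  obtain ⟨k, rfl | rfl⟩ := Nat.even_or_odd' j
  · rw [← mul_one (3 ^ (2 * k)), numDiagReps_three_pow_mul, numDiagReps_one]
    norm_num
  · rw [pow_succ, numDiagReps_three_pow_mul, numDiagReps_three]
    norm_num [pow_succ]

/-! ### Composition and inclusion-exclusion -/

/-- Composition with an element `(u, v)` and with its conjugate: if every representation of `n` is
divisible by one of them after scaling by `l`, then those of `n` are counted by inclusion and
exclusion. -/
theorem numDiagReps_add_ncard {n n' : ℕ} {u v k l : ℤ} (hk : k ≠ 0) (hl : l ≠ 0)
    (huv : u ^ 2 + 15 * v ^ 2 = k * l) (hn : (n : ℤ) * k = n' * l)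
    (hdvd : ∀ x y : ℤ, x ^ 2 + 15 * y ^ 2 = n' → k ∣ x * u - 15 * y * v ∧ k ∣ x * v + y * u)
    (hsplit : ∀ x y : ℤ, x ^ 2 + 15 * y ^ 2 = n →
      (l ∣ x * u + 15 * y * v ∧ l ∣ y * u - x * v) ∨
      (l ∣ x * u - 15 * y * v ∧ l ∣ y * u + x * v)) :
    numDiagReps 1 15 n + {x : ℤ × ℤ | x ∈ diagReps 1 15 n ∧
      (l ∣ x.1 * u + 15 * x.2 * v ∧ l ∣ x.2 * u - x.1 * v) ∧
      (l ∣ x.1 * u - 15 * x.2 * v ∧ l ∣ x.2 * u + x.1 * v)}.ncard =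
      2 * numDiagReps 1 15 n' := by
  set A : Set (ℤ × ℤ) := {x | x ∈ diagReps 1 15 n ∧
    (l ∣ x.1 * u + 15 * x.2 * v ∧ l ∣ x.2 * u - x.1 * v)} with hA
  set B : Set (ℤ × ℤ) := {x | x ∈ diagReps 1 15 n ∧
    (l ∣ x.1 * u - 15 * x.2 * v ∧ l ∣ x.2 * u + x.1 * v)} with hB
  have hAf : A.Finite := (finite_diagReps_one_fifteen n).subset fun x hx => hx.1
  have hBf : B.Finite := (finite_diagReps_one_fifteen n).subset fun x hx => hx.1
  have hunion : A ∪ B = diagReps 1 15 n := by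
    ext x
    constructor
    · rintro (h | h) <;> exact h.1
    · intro h
      rcases hsplit x.1 x.2 (mem_diagReps_one_fifteen.1 h) with h' | h'
      · exact Or.inl ⟨h, h'⟩
      · exact Or.inr ⟨h, h'⟩
  have hinter : A ∩ B = {x : ℤ × ℤ | x ∈ diagReps 1 15 n ∧
      (l ∣ x.1 * u + 15 * x.2 * v ∧ l ∣ x.2 * u - x.1 * v) ∧
      (l ∣ x.1 * u - 15 * x.2 * v ∧ l ∣ x.2 * u + x.1 * v)} := by
    ext x
    simp only [hA, hB, Set.mem_inter_iff, Set.mem_ofPred_eq]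
    tauto
  -- Conjugation exchanges the two divisibility conditions.
  have hAB : (fun x : ℤ × ℤ => (x.1, -x.2)) '' A = B := by
    ext ⟨x, y⟩
    simp only [Set.mem_image, hA, hB, Set.mem_ofPred_eq, mem_diagReps_one_fifteen, Prod.mk.injEq,
      Prod.exists]
    constructor
    · rintro ⟨a, b, ⟨h1, h2, h3⟩, rfl, rfl⟩
      refine ⟨by linarith, ?_, ?_⟩
      · convert h2 using 1; ring
      · rw [show -b * u + a * v = -(b * u - a * v) by ring, dvd_neg]; exact h3
    · rintro ⟨h1, h2, h3⟩
      refine ⟨x, -y, ⟨by linarith, ?_, ?_⟩, rfl, by ring⟩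
      · convert h2 using 1; ring
      · rw [show -y * u - x * v = -(y * u + x * v) by ring, dvd_neg]; exact h3
  have hBcard : B.ncard = A.ncard := by
    rw [← hAB]
    apply Set.ncard_image_of_injective
    rintro ⟨x, y⟩ ⟨z, w⟩ h
    simpa using h
  have hAcard : A.ncard = numDiagReps 1 15 n' := by
    -- The map is multiplication by (u - v√-15)/l, of norm k/l; its inverse is multiplication by (u
    -- + v√-15)/k, integral by `hdvd`.
    have himg : (fun x : ℤ × ℤ => ((x.1 * u + 15 * x.2 * v) / l, (x.2 * u - x.1 * v) / l)) '' A =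
        diagReps 1 15 n' := by
      ext ⟨a, b⟩
      simp only [Set.mem_image, hA, Set.mem_ofPred_eq, mem_diagReps_one_fifteen, Prod.mk.injEq,
        Prod.exists]
      constructor
      · rintro ⟨x, y, ⟨h1, ⟨c, hc⟩, ⟨d, hd⟩⟩, rfl, rfl⟩
        rw [hc, hd, Int.mul_ediv_cancel_left _ hl, Int.mul_ediv_cancel_left _ hl]
        apply mul_left_cancel₀ (mul_ne_zero hl hl)
        linear_combination (-(x * u + 15 * y * v) - l * c) * hc +
          15 * (-(y * u - x * v) - l * d) * hd + (u ^ 2 + 15 * v ^ 2) * h1 + n * huv + l * hn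
      · intro h
        obtain ⟨⟨x, hx⟩, ⟨y, hy⟩⟩ := hdvd a b h
        have e1 : x * u + 15 * y * v = l * a := by
          apply mul_left_cancel₀ hk
          linear_combination a * huv - u * hx - 15 * v * hy
        have e2 : y * u - x * v = l * b := by
          apply mul_left_cancel₀ hk
          linear_combination b * huv + v * hx - u * hy
        refine ⟨x, y, ⟨?_, ⟨a, e1⟩, ⟨b, e2⟩⟩, ?_, ?_⟩
        · apply mul_left_cancel₀ (mul_ne_zero hk hk)
          linear_combination (-(a * u - 15 * b * v) - k * x) * hx +
            15 * (-(a * v + b * u) - k * y) * hy + (u ^ 2 + 15 * v ^ 2) * h + n' * huv - k * hn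
        · rw [e1, Int.mul_ediv_cancel_left _ hl]
        · rw [e2, Int.mul_ediv_cancel_left _ hl]
    unfold numDiagReps
    rw [← himg]
    symm
    apply Set.InjOn.ncard_image
    rintro ⟨x, y⟩ ⟨-, ⟨c, hc⟩, ⟨d, hd⟩⟩ ⟨z, w⟩ ⟨-, ⟨c', hc'⟩, ⟨d', hd'⟩⟩ h
    simp only at hc hd hc' hd'
    simp only [hc, hd, hc', hd', Int.mul_ediv_cancel_left _ hl, Prod.mk.injEq] at h
    obtain ⟨rfl, rfl⟩ := h
    have hkl := mul_ne_zero hk hl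
    rw [Prod.mk.injEq]
    constructor <;> apply mul_left_cancel₀ hkl
    · linear_combination (z - x) * huv + u * (hc - hc') - 15 * v * (hd - hd')
    · linear_combination (w - y) * huv + v * (hc - hc') + u * (hd - hd')
  rw [← hinter, numDiagReps, ← hunion, Set.ncard_union_add_ncard_inter A B hAf hBf, hBcard, hAcard]
  ring

/-! ### The prime 2 -/

theorem even_add_of_even_sq_add_fifteen_mul_sq {x y : ℤ} (h : Even (x ^ 2 + 15 * y ^ 2)) :
    Even (x + y) := by
  simp only [Int.even_add, Int.even_mul, Int.even_pow] at h ⊢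
  revert h
  simp [show ¬ Even (15 : ℤ) by decide]

/-- Composition with 3 + √-15, of norm 24 = 6 · 4. The overlap consists of the doubles of the
representations of 2m. -/
theorem numDiagReps_eight_mul (m : ℕ) :
    numDiagReps 1 15 (8 * m) + numDiagReps 1 15 (2 * m) = 2 * numDiagReps 1 15 (12 * m) := by
  rw [← numDiagReps_add_ncard (n := 8 * m) (n' := 12 * m) (u := 3) (v := 1) (k := 6) (l := 4)
    (by norm_num) (by norm_num) (by norm_num) (by push_cast; ring)]
  · congr 1
    rw [numDiagReps, ← Set.ncard_image_of_injective (f := fun x : ℤ × ℤ => (2 * x.1, 2 * x.2))]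
    · congr 1
      ext ⟨x, y⟩
      simp only [Set.mem_image, Set.mem_ofPred_eq, mem_diagReps_one_fifteen, Prod.mk.injEq,
        Prod.exists]
      push_cast
      constructor
      · rintro ⟨a, b, h, rfl, rfl⟩
        obtain ⟨c, hc⟩ := even_add_of_even_sq_add_fifteen_mul_sq (x := a) (y := b) ⟨m, by linarith⟩
        refine ⟨by linarith, ?_, ?_⟩ <;> omega
      · rintro ⟨h, h1, h2⟩
        obtain ⟨a, rfl⟩ : (2 : ℤ) ∣ x := by omega
        obtain ⟨b, rfl⟩ : (2 : ℤ) ∣ y := by omega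
        exact ⟨a, b, by linarith, rfl, rfl⟩
    · rintro ⟨x, y⟩ ⟨z, w⟩ h
      simp only [Prod.mk.injEq] at h ⊢
      omega
  · intro x y h
    push_cast at h
    have h3 : (3 : ℤ) ∣ x := by
      apply Int.prime_three.dvd_of_dvd_pow (n := 2)
      exact ⟨4 * m - 5 * y ^ 2, by linarith⟩
    obtain ⟨c, hc⟩ := even_add_of_even_sq_add_fifteen_mul_sq (x := x) (y := y)
      ⟨6 * m, by linarith⟩
    obtain ⟨t, rfl⟩ := h3
    obtain rfl : y = 2 * c - 3 * t := by linarith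
    exact ⟨⟨9 * t - 5 * c, by ring⟩, ⟨c - t, by ring⟩⟩
  · intro x y h
    push_cast at h
    obtain ⟨c, hc⟩ := even_add_of_even_sq_add_fifteen_mul_sq (x := x) (y := y)
      ⟨4 * m, by linarith⟩
    -- For odd x and y, the alternative is decided by x ≡ -y or x ≡ y mod 4; for even ones both
    -- hold.
    rcases Int.even_or_odd' x with ⟨a, rfl | rfl⟩
    · obtain ⟨b, rfl⟩ : (2 : ℤ) ∣ y := by omega
      obtain ⟨d, hd⟩ := even_add_of_even_sq_add_fifteen_mul_sq (x := a) (y := b) ⟨m, by linarith⟩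
      omega
    · omega

theorem sq_add_fifteen_mul_sq_emod_four (x y : ℤ) : (x ^ 2 + 15 * y ^ 2) % 4 ≠ 2 := by
  obtain ⟨a, rfl | rfl⟩ := Int.even_or_odd' x <;> obtain ⟨b, rfl | rfl⟩ := Int.even_or_odd' y <;>
    ring_nf <;> omega

/-- Two odd coordinates would give 1 + 15 ≡ 0 mod 8, whereas 4m ≡ 4. -/
theorem even_of_sq_add_fifteen_mul_sq {x y : ℤ} {m : ℤ} (hm : Odd m)
    (h : x ^ 2 + 15 * y ^ 2 = 4 * m) : (2 : ℤ) ∣ x ∧ (2 : ℤ) ∣ y := by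
  obtain ⟨c, rfl⟩ := hm
  obtain ⟨a, rfl | rfl⟩ := Int.even_or_odd' x <;> obtain ⟨b, rfl | rfl⟩ := Int.even_or_odd' y
  · simp
  · ring_nf at h; omega
  · ring_nf at h; omega
  · obtain ⟨d, hd⟩ := Int.even_mul_succ_self a
    obtain ⟨e, he⟩ := Int.even_mul_succ_self b
    ring_nf at h hd he
    omega

theorem numDiagReps_two_mul_odd {m : ℕ} (hm : Odd m) : numDiagReps 1 15 (2 * m) = 0 := by
  have : diagReps 1 15 (2 * m) = ∅ := by
    ext ⟨x, y⟩
    rw [mem_diagReps_one_fifteen]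
    simp only [Set.mem_empty_iff_false, iff_false]
    intro h
    apply sq_add_fifteen_mul_sq_emod_four x y
    obtain ⟨c, rfl⟩ := hm
    rw [h]
    push_cast
    omega
  rw [numDiagReps, this, Set.ncard_empty]

theorem numDiagReps_four_mul_odd {m : ℕ} (hm : Odd m) :
    numDiagReps 1 15 (4 * m) = numDiagReps 1 15 m := by
  apply numDiagReps_sq_mul (d := 2) (by norm_num)
  intro x y h
  push_cast at h ⊢
  exact even_of_sq_add_fifteen_mul_sq (m := m) (by exact_mod_cast hm) (by linarith)

/-- The recurrence from `numDiagReps_eight_mul` makes the coefficients an arithmetic progression; m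
varies in the induction because each step moves a factor 3 into it. -/
theorem numDiagReps_two_pow_add_two_mul (k : ℕ) {m : ℕ} (hm : Odd m) :
    numDiagReps 1 15 (2 ^ (k + 2) * m) = (k + 1) * numDiagReps 1 15 (3 ^ k * m) := by
  induction k using Nat.twoStepInduction generalizing m with
  | zero => simpa using numDiagReps_four_mul_odd hm
  | one =>
    have h := numDiagReps_eight_mul m
    have h3 : Odd (3 * m) := Odd.mul (by decide) hm
    rw [numDiagReps_two_mul_odd hm, show 12 * m = 4 * (3 * m) by ring,
      numDiagReps_four_mul_odd h3] at h
    simpa using h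
  | more k ih1 ih2 =>
    have h := numDiagReps_eight_mul (2 ^ (k + 1) * m)
    have h3 : Odd (3 * m) := Odd.mul (by decide) hm
    rw [show 12 * (2 ^ (k + 1) * m) = 2 ^ (k + 1 + 2) * (3 * m) by ring, ih2 h3,
      show 2 * (2 ^ (k + 1) * m) = 2 ^ (k + 2) * m by ring, ih1 hm,
      show 3 ^ (k + 1) * (3 * m) = 9 * (3 ^ k * m) by ring, numDiagReps_nine_mul] at h
    rw [show 2 ^ (k + 2 + 2) * m = 8 * (2 ^ (k + 1) * m) by ring,
      show 3 ^ (k + 2) * m = 9 * (3 ^ k * m) by ring, numDiagReps_nine_mul]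
    linarith

theorem numDiagReps_two_pow_mul (a : ℕ) {m : ℕ} (hm : Odd m) :
    (numDiagReps 1 15 (2 ^ a * m) : ℚ) = |(a : ℚ) - 1| * numDiagReps 1 15 (3 ^ a * m) := by
  match a with
  | 0 => simp
  | 1 => simp [numDiagReps_two_mul_odd hm]
  | k + 2 =>
    rw [numDiagReps_two_pow_add_two_mul k hm, show 3 ^ (k + 2) * m = 9 * (3 ^ k * m) by ring,
      numDiagReps_nine_mul, abs_of_nonneg]
    · push_cast; ring
    · push_cast; linarith [(Nat.cast_nonneg k : (0 : ℚ) ≤ k)]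

/-! ### The character of -15 and inert primes -/

/-- As 15 ≡ 3 mod 4, the reciprocity sign cancels the symbol of -1. -/
theorem jacobiSym_neg_fifteen {p : ℕ} (hp : Odd p) : jacobiSym (-15) p = jacobiSym p 15 := by
  have h15 : ((15 : ℕ) : ℤ) = 15 := rfl
  rw [jacobiSym.neg _ hp, ← h15]
  rcases Nat.odd_mod_four_iff.1 (Nat.odd_iff.1 hp) with h | h
  · rw [ZMod.χ₄_nat_one_mod_four h,
      jacobiSym.quadratic_reciprocity_one_mod_four' (by decide) h, one_mul]
  · rw [ZMod.χ₄_nat_three_mod_four h,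
      jacobiSym.quadratic_reciprocity_three_mod_four (by norm_num) h]
    ring

theorem jacobiSym_neg_fifteen_eq_one {p : ℕ} (hp : Odd p)
    (h : p % 15 = 1 ∨ p % 15 = 2 ∨ p % 15 = 4 ∨ p % 15 = 8) : jacobiSym (-15) p = 1 := by
  rw [jacobiSym_neg_fifteen hp, jacobiSym.mod_left]
  norm_cast
  rcases h with h | h | h | h <;> rw [h] <;> norm_num

theorem jacobiSym_neg_fifteen_eq_neg_one {p : ℕ} (hp : Odd p)
    (h : p % 15 = 7 ∨ p % 15 = 11 ∨ p % 15 = 13 ∨ p % 15 = 14) : jacobiSym (-15) p = -1 := by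
  rw [jacobiSym_neg_fifteen hp, jacobiSym.mod_left]
  norm_cast
  rcases h with h | h | h | h <;> rw [h] <;> norm_num <;> rfl

theorem dvd_of_inert {q : ℕ} (hq : q.Prime)
    (h : q % 15 = 7 ∨ q % 15 = 11 ∨ q % 15 = 13 ∨ q % 15 = 14) {x y : ℤ}
    (hxy : (q : ℤ) ∣ x ^ 2 + 15 * y ^ 2) : (q : ℤ) ∣ x ∧ (q : ℤ) ∣ y := by
  have := Fact.mk hq
  have hodd : Odd q := hq.odd_of_ne_two (by rintro rfl; omega)
  exact jacobiSym.prime_dvd_of_eq_neg_one (jacobiSym_neg_fifteen_eq_neg_one hodd h)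
    (by convert hxy using 1; ring)

theorem numDiagReps_inert_pow_mul {q : ℕ} (hq : q.Prime)
    (h : q % 15 = 7 ∨ q % 15 = 11 ∨ q % 15 = 13 ∨ q % 15 = 14) (w : ℕ) {m : ℕ} (hm : ¬ q ∣ m) :
    (numDiagReps 1 15 (q ^ w * m) : ℚ) = (1 + (-1) ^ w) / 2 * numDiagReps 1 15 m := by
  induction w using Nat.twoStepInduction with
  | zero => norm_num
  | one =>
    have : diagReps 1 15 (q ^ 1 * m) = ∅ := by
      ext ⟨x, y⟩
      rw [mem_diagReps_one_fifteen]
      simp only [Set.mem_empty_iff_false, iff_false]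
      intro hxy
      push_cast at hxy
      obtain ⟨⟨x, rfl⟩, ⟨y, rfl⟩⟩ := dvd_of_inert hq h ⟨m, by rw [hxy]; ring⟩
      apply hm
      have hq0 : (q : ℤ) ≠ 0 := by exact_mod_cast hq.ne_zero
      rw [← Int.natCast_dvd_natCast]
      exact ⟨x ^ 2 + 15 * y ^ 2, mul_left_cancel₀ hq0 (by linarith)⟩
    rw [numDiagReps, this, Set.ncard_empty]
    norm_num
  | more k ih1 _ =>
    rw [show q ^ (k + 2) * m = q ^ 2 * (q ^ k * m) by ring, numDiagReps_sq_mul hq.pos, ih1]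
    · ring
    · intro x y hxy
      exact dvd_of_inert hq h ⟨q * (q ^ k * m : ℕ), by rw [hxy]; ring⟩

/-! ### Split primes: a representation of p or 3p -/

/-- Thue's lemma with the box adapted to the form `x² + 15 y²`. -/
theorem exists_sq_add_fifteen_mul_sq_eq_mul {p : ℕ} (hp : p.Prime)
    (h : IsSquare ((-15 : ℤ) : ZMod p)) :
    ∃ x y : ℤ, ∃ k : ℕ, 0 < k ∧ k < 8 ∧ x ^ 2 + 15 * y ^ 2 = k * p := by
  have := Fact.mk hp
  obtain ⟨s, hs⟩ := h
  -- Sides 2√p and √p/2 have product p, enough for the pigeonhole, and bound the form by 4p + 15p/4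
  -- < 8p.
  set A := Nat.sqrt (4 * p) with hA
  set B := Nat.sqrt (p / 4) with hB
  have hA1 : A * A ≤ 4 * p := Nat.sqrt_le _
  have hA2 : 4 * p < (A + 1) * (A + 1) := Nat.lt_succ_sqrt _
  have hB1 : B * B ≤ p / 4 := Nat.sqrt_le _
  have hB2 : p / 4 < (B + 1) * (B + 1) := Nat.lt_succ_sqrt _
  have hcard : p < (A + 1) * (B + 1) := by
    have h1 : p < 4 * ((B + 1) * (B + 1)) := by omega
    by_contra! hcon
    have h2 := Nat.mul_le_mul hcon hcon
    have h3 : 4 * p * p < ((A + 1) * (A + 1)) * (4 * ((B + 1) * (B + 1))) :=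
      Nat.mul_lt_mul'' hA2 h1
    nlinarith
  obtain ⟨⟨a, b⟩, hab, ⟨c, d⟩, hcd, hne, heq⟩ :=
    Finset.exists_ne_map_eq_of_card_lt_of_maps_to
      (s := Finset.range (A + 1) ×ˢ Finset.range (B + 1)) (t := (Finset.univ : Finset (ZMod p)))
      (f := fun x => (x.1 : ZMod p) - s * x.2)
      (by rw [Finset.card_product, Finset.card_range, Finset.card_range, Finset.card_univ,
            ZMod.card]; exact hcard)
      (fun _ _ => Finset.mem_univ _)
  simp only [Finset.mem_product, Finset.mem_range] at hab hcd heq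
  set x : ℤ := (a : ℤ) - c with hx
  set y : ℤ := (b : ℤ) - d with hy
  have hdvd : (p : ℤ) ∣ x ^ 2 + 15 * y ^ 2 := by
    rw [← ZMod.intCast_zmod_eq_zero_iff_dvd, hx, hy]
    push_cast at hs ⊢
    have : (a : ZMod p) - c = s * (b - d) := by linear_combination heq
    rw [this]
    linear_combination -((b : ZMod p) - d) ^ 2 * hs
  have hpos : 0 < x ^ 2 + 15 * y ^ 2 := by
    by_contra! hcon
    have hx0 : x = 0 := by nlinarith [sq_nonneg x, sq_nonneg y]
    have hy0 : y = 0 := by nlinarith [sq_nonneg x, sq_nonneg y]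
    apply hne
    rw [Prod.mk.injEq]
    omega
  have hx2 : x ^ 2 ≤ A * A := by
    rw [← pow_two]; apply sq_le_sq'  <;> omega
  have hy2 : y ^ 2 ≤ B * B := by
    rw [← pow_two]; apply sq_le_sq' <;> omega
  have hp0 : (0 : ℤ) < p := by exact_mod_cast hp.pos
  have hlt : x ^ 2 + 15 * y ^ 2 < 8 * p := by
    have h1 : (A : ℤ) * A ≤ 4 * p := by exact_mod_cast hA1
    have h2 : (B : ℤ) * B * 4 ≤ p := by exact_mod_cast (by omega : B * B * 4 ≤ p)
    linarith
  obtain ⟨k, hk⟩ := hdvd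
  rw [hk] at hpos hlt
  have hk0 : 0 < k := pos_of_mul_pos_right hpos hp0.le
  have hk8 : k < 8 := by nlinarith
  lift k to ℕ using hk0.le
  exact ⟨x, y, k, by exact_mod_cast hk0, by exact_mod_cast hk8, by rw [hk]; ring⟩

/-- Of the multiples kp with k < 8 from Thue's lemma, 2 and 6 fail mod 4, 4 descends to 1 by
halving, 5 turns into 3 by exchanging coordinates, and 7, being inert, would force p = 7. -/
theorem exists_sq_add_fifteen_mul_sq_of_split {p : ℕ} (hp : p.Prime) (hp2 : p ≠ 2)
    (h : p % 15 = 1 ∨ p % 15 = 2 ∨ p % 15 = 4 ∨ p % 15 = 8) :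
    ∃ u v : ℤ, u ^ 2 + 15 * v ^ 2 = p ∨ u ^ 2 + 15 * v ^ 2 = 3 * p := by
  have := Fact.mk hp
  have hodd := hp.odd_of_ne_two hp2
  obtain ⟨x, y, k, hk0, hk8, hxy⟩ := exists_sq_add_fifteen_mul_sq_eq_mul hp
    (ZMod.isSquare_of_jacobiSym_eq_one (jacobiSym_neg_fifteen_eq_one hodd h))
  have hmod := sq_add_fifteen_mul_sq_emod_four x y
  have hodd' : Odd (p : ℤ) := by exact_mod_cast hodd
  interval_cases k
  · exact ⟨x, y, Or.inl (by simpa using hxy)⟩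
  · obtain ⟨c, hc⟩ := hodd'
    push_cast at hxy
    omega
  · exact ⟨x, y, Or.inr (by exact_mod_cast hxy)⟩
  · obtain ⟨⟨x, rfl⟩, ⟨y, rfl⟩⟩ := even_of_sq_add_fifteen_mul_sq hodd' (by exact_mod_cast hxy)
    push_cast at hxy
    exact ⟨x, y, Or.inl (by linarith)⟩
  · push_cast at hxy
    have : (5 : ℤ) ∣ x := by
      apply (Nat.prime_iff_prime_int.1 Nat.prime_five).dvd_of_dvd_pow (n := 2)
      exact ⟨p - 3 * y ^ 2, by push_cast; linarith⟩
    obtain ⟨x, rfl⟩ := this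
    exact ⟨3 * y, x, Or.inr (by linarith)⟩
  · obtain ⟨c, hc⟩ := hodd'
    push_cast at hxy
    omega
  · push_cast at hxy
    obtain ⟨⟨x, rfl⟩, ⟨y, rfl⟩⟩ := dvd_of_inert (q := 7) (by norm_num) (by norm_num)
      ⟨(p : ℤ), by push_cast; exact hxy⟩
    push_cast at hxy
    have h7 : 7 ∣ p := by
      rw [← Int.natCast_dvd_natCast]
      exact ⟨x ^ 2 + 15 * y ^ 2, by push_cast; linarith⟩
    rw [Nat.prime_dvd_prime_iff_eq (by norm_num) hp] at h7
    omega

/-- The exponent `δ` for which a split odd prime `p` has `3 ^ δ * p` of the form `x² + 15 y²`. -/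
def genus (p : ℕ) : ℕ := if p % 15 = 2 ∨ p % 15 = 8 then 1 else 0

/-- The genus character: exactly one of p and 3p is a square mod 5, which decides which of them is
represented. -/
theorem sq_add_fifteen_mul_sq_emod_five (x y : ℤ) :
    (x ^ 2 + 15 * y ^ 2) % 5 = 0 ∨ (x ^ 2 + 15 * y ^ 2) % 5 = 1 ∨
      (x ^ 2 + 15 * y ^ 2) % 5 = 4 := by
  have h : (x ^ 2 + 15 * y ^ 2) % 5 = (x % 5) ^ 2 % 5 := by
    rw [show x ^ 2 + 15 * y ^ 2 = x ^ 2 + 5 * (3 * y ^ 2) by ring, Int.add_mul_emod_self_left]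
    exact ((Int.mod_modEq x 5).pow 2).symm
  rw [h]
  have h0 := Int.emod_nonneg x (by norm_num : (5 : ℤ) ≠ 0)
  have h1 := Int.emod_lt_of_pos x (by norm_num : (0 : ℤ) < 5)
  interval_cases x % 5 <;> norm_num

theorem exists_sq_add_fifteen_mul_sq {p : ℕ} (hp : p.Prime) (hp2 : p ≠ 2)
    (h : p % 15 = 1 ∨ p % 15 = 2 ∨ p % 15 = 4 ∨ p % 15 = 8) :
    ∃ u v : ℤ, u ^ 2 + 15 * v ^ 2 = 3 ^ genus p * p := by
  obtain ⟨u, v, huv⟩ := exists_sq_add_fifteen_mul_sq_of_split hp hp2 h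
  refine ⟨u, v, ?_⟩
  have h5 := sq_add_fifteen_mul_sq_emod_five u v
  unfold genus
  rcases huv with huv | huv
  · rw [if_neg (by omega), huv]; simp
  · rw [if_pos (by omega), huv]; simp

/-! ### Powers of split primes -/

/-- Modulo p, (yu - xv)(yu + xv) = y²u² - x²v² vanishes; once one factor does, the norm identity
gives the other coordinate. -/
theorem dvd_or_dvd_of_split {p : ℕ} (hp : p.Prime) {x y u v : ℤ}
    (hxy : (p : ℤ) ∣ x ^ 2 + 15 * y ^ 2) (huv : (p : ℤ) ∣ u ^ 2 + 15 * v ^ 2) :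
    ((p : ℤ) ∣ x * u + 15 * y * v ∧ (p : ℤ) ∣ y * u - x * v) ∨
      ((p : ℤ) ∣ x * u - 15 * y * v ∧ (p : ℤ) ∣ y * u + x * v) := by
  have hp' := Nat.prime_iff_prime_int.1 hp
  obtain ⟨c, hc⟩ := hxy
  obtain ⟨d, hd⟩ := huv
  have h : (p : ℤ) ∣ (y * u - x * v) * (y * u + x * v) :=
    ⟨y ^ 2 * d - c * v ^ 2, by linear_combination y ^ 2 * hd - v ^ 2 * hc⟩
  rcases hp'.dvd_or_dvd h with h | h
  · refine Or.inl ⟨hp'.dvd_of_dvd_pow (n := 2) ?_, h⟩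
    obtain ⟨e, he⟩ := h
    exact ⟨c * (u ^ 2 + 15 * v ^ 2) - 15 * e * (y * u - x * v), by
      linear_combination (u ^ 2 + 15 * v ^ 2) * hc - 15 * (y * u - x * v) * he⟩
  · refine Or.inr ⟨hp'.dvd_of_dvd_pow (n := 2) ?_, h⟩
    obtain ⟨e, he⟩ := h
    exact ⟨c * (u ^ 2 + 15 * v ^ 2) - 15 * e * (y * u + x * v), by
      linear_combination (u ^ 2 + 15 * v ^ 2) * hc - 15 * (y * u + x * v) * he⟩

theorem numDiagReps_split_add_ncard {p : ℕ} (hp : p.Prime) (hp2 : p ≠ 2)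
    (h : p % 15 = 1 ∨ p % 15 = 2 ∨ p % 15 = 4 ∨ p % 15 = 8) (m : ℕ) :
    numDiagReps 1 15 (p * m) +
      {x : ℤ × ℤ | x ∈ diagReps 1 15 (p * m) ∧ (p : ℤ) ∣ x.1 ∧ (p : ℤ) ∣ x.2}.ncard =
      2 * numDiagReps 1 15 (3 ^ genus p * m) := by
  obtain ⟨u, v, huv⟩ := exists_sq_add_fifteen_mul_sq hp hp2 h
  have hp' := Nat.prime_iff_prime_int.1 hp
  have hp0 : (p : ℤ) ≠ 0 := hp'.ne_zero
  have hg : genus p = 0 ∨ genus p = 1 := by unfold genus; split_ifs <;> simp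
  rw [← numDiagReps_add_ncard (n := p * m) (k := 3 ^ genus p) (l := p) (by positivity) hp0 huv
    (by push_cast; ring)]
  · congr 2
    ext ⟨x, y⟩
    simp only [Set.mem_ofPred_eq]
    refine and_congr_right fun _ => ?_
    constructor
    · rintro ⟨⟨x, rfl⟩, ⟨y, rfl⟩⟩
      exact ⟨⟨⟨x * u + 15 * y * v, by ring⟩, ⟨y * u - x * v, by ring⟩⟩,
        ⟨⟨x * u - 15 * y * v, by ring⟩, ⟨y * u + x * v, by ring⟩⟩⟩
    · rintro ⟨⟨h1, h2⟩, ⟨h3, h4⟩⟩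
      -- Adding the two conditions gives p ∣ 2ux and p ∣ 2uy. If p ∣ u then p ∣ v, so p² would
      -- divide 3^δ p.
      have hu : ¬ (p : ℤ) ∣ 2 * u := by
        intro hu
        rcases hp'.dvd_or_dvd hu with h2 | hu
        · have := (Nat.prime_dvd_prime_iff_eq hp Nat.prime_two).1 (by exact_mod_cast h2)
          exact hp2 this
        · have h15 : ¬ (p : ℤ) ∣ 15 := by
            intro h15
            have h15 : p ∣ 3 * 5 := by exact_mod_cast h15
            rcases hp.dvd_mul.1 h15 with h3 | h5
            · rw [Nat.prime_dvd_prime_iff_eq hp Nat.prime_three] at h3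
              omega
            · rw [Nat.prime_dvd_prime_iff_eq hp Nat.prime_five] at h5
              omega
          have hv : (p : ℤ) ∣ v := by
            have : (p : ℤ) ∣ 15 * v ^ 2 := by
              obtain ⟨c, hc⟩ := hu
              exact ⟨3 ^ genus p - c * u, by linear_combination huv - u * hc⟩
            exact hp'.dvd_of_dvd_pow ((hp'.dvd_or_dvd this).resolve_left h15)
          obtain ⟨c, rfl⟩ := hu
          obtain ⟨d, rfl⟩ := hv
          have : (p : ℤ) ∣ 3 ^ genus p :=
            ⟨c ^ 2 + 15 * d ^ 2, mul_right_cancel₀ hp0 (by linear_combination -huv)⟩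
          apply h15
          have h3 := hp'.dvd_of_dvd_pow this
          exact h3.trans ⟨5, by norm_num⟩
      constructor
      · refine (hp'.dvd_or_dvd (?_ : (p : ℤ) ∣ 2 * u * x)).resolve_left hu
        rw [show 2 * u * x = (x * u + 15 * y * v) + (x * u - 15 * y * v) by ring]
        exact dvd_add h1 h3
      · refine (hp'.dvd_or_dvd (?_ : (p : ℤ) ∣ 2 * u * y)).resolve_left hu
        rw [show 2 * u * y = (y * u - x * v) + (y * u + x * v) by ring]
        exact dvd_add h2 h4
  · intro x y hxy
    rcases hg with hg | hg
    · rw [hg]; simp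
    · rw [hg] at hxy huv ⊢
      rw [pow_one] at *
      push_cast at hxy
      have hx : (3 : ℤ) ∣ x := by
        apply Int.prime_three.dvd_of_dvd_pow (n := 2)
        exact ⟨m - 5 * y ^ 2, by linarith⟩
      have hu : (3 : ℤ) ∣ u := by
        apply Int.prime_three.dvd_of_dvd_pow (n := 2)
        exact ⟨p - 5 * v ^ 2, by linarith⟩
      obtain ⟨x, rfl⟩ := hx
      obtain ⟨u, rfl⟩ := hu
      exact ⟨⟨3 * x * u - 5 * y * v, by ring⟩, ⟨x * v + y * u, by ring⟩⟩
  · intro x y hxy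
    apply dvd_or_dvd_of_split hp
    · rw [hxy]; exact ⟨m, by push_cast; ring⟩
    · rw [huv]; exact ⟨3 ^ genus p, by ring⟩

theorem numDiagReps_split_mul {p : ℕ} (hp : p.Prime) (hp2 : p ≠ 2)
    (h : p % 15 = 1 ∨ p % 15 = 2 ∨ p % 15 = 4 ∨ p % 15 = 8) {m : ℕ} (hm : ¬ p ∣ m) :
    numDiagReps 1 15 (p * m) = 2 * numDiagReps 1 15 (3 ^ genus p * m) := by
  have hp0 : (p : ℤ) ≠ 0 := by exact_mod_cast hp.ne_zero
  rw [← numDiagReps_split_add_ncard hp hp2 h]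
  have : {x : ℤ × ℤ | x ∈ diagReps 1 15 (p * m) ∧ (p : ℤ) ∣ x.1 ∧ (p : ℤ) ∣ x.2} = ∅ := by
    ext ⟨x, y⟩
    simp only [Set.mem_ofPred_eq, mem_diagReps_one_fifteen, Set.mem_empty_iff_false, iff_false]
    rintro ⟨hxy, ⟨x, rfl⟩, ⟨y, rfl⟩⟩
    apply hm
    rw [← Int.natCast_dvd_natCast]
    push_cast at hxy
    exact ⟨x ^ 2 + 15 * y ^ 2, mul_left_cancel₀ hp0 (by linarith)⟩
  rw [this, Set.ncard_empty, add_zero]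

/-- Here the overlap is p times the representations of m. -/
theorem numDiagReps_split_sq_mul {p : ℕ} (hp : p.Prime) (hp2 : p ≠ 2)
    (h : p % 15 = 1 ∨ p % 15 = 2 ∨ p % 15 = 4 ∨ p % 15 = 8) (m : ℕ) :
    numDiagReps 1 15 (p ^ 2 * m) + numDiagReps 1 15 m =
      2 * numDiagReps 1 15 (p * (3 ^ genus p * m)) := by
  have hp0 : (p : ℤ) ≠ 0 := by exact_mod_cast hp.ne_zero
  have key := numDiagReps_split_add_ncard hp hp2 h (p * m)
  rw [show 3 ^ genus p * (p * m) = p * (3 ^ genus p * m) by ring,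
    show p * (p * m) = p ^ 2 * m by ring] at key
  rw [← key]
  congr 1
  rw [numDiagReps, ← Set.ncard_image_of_injective (f := fun x : ℤ × ℤ => (p * x.1, p * x.2))]
  · congr 1
    ext ⟨x, y⟩
    simp only [Set.mem_image, Set.mem_ofPred_eq, mem_diagReps_one_fifteen, Prod.mk.injEq,
      Prod.exists]
    push_cast
    constructor
    · rintro ⟨a, b, hab, rfl, rfl⟩
      exact ⟨by linear_combination (p : ℤ) ^ 2 * hab, dvd_mul_right _ _, dvd_mul_right _ _⟩
    · rintro ⟨hab, ⟨a, rfl⟩, ⟨b, rfl⟩⟩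
      exact ⟨a, b, mul_left_cancel₀ (pow_ne_zero 2 hp0) (by linear_combination hab), rfl, rfl⟩
  · rintro ⟨x, y⟩ ⟨z, w⟩ hxz
    simp only [Prod.mk.injEq, mul_right_inj' hp0] at hxz ⊢
    exact hxz

theorem not_dvd_three_pow_mul {p : ℕ} (hp : p.Prime) (h3 : p ≠ 3) {m : ℕ} (hm : ¬ p ∣ m)
    (j : ℕ) : ¬ p ∣ 3 ^ j * m := by
  rw [hp.dvd_mul]
  rintro (h | h)
  · exact h3 ((Nat.prime_dvd_prime_iff_eq hp Nat.prime_three).1 (hp.dvd_of_dvd_pow h))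
  · exact hm h

theorem numDiagReps_three_pow_mul_three_pow_mul (j m : ℕ) :
    numDiagReps 1 15 (3 ^ j * (3 ^ j * m)) = numDiagReps 1 15 m := by
  rw [← numDiagReps_three_pow_mul j m]
  congr 1
  ring

theorem numDiagReps_split_pow_mul {p : ℕ} (hp : p.Prime) (hp2 : p ≠ 2)
    (h : p % 15 = 1 ∨ p % 15 = 2 ∨ p % 15 = 4 ∨ p % 15 = 8) (k : ℕ) {m : ℕ} (hm : ¬ p ∣ m) :
    numDiagReps 1 15 (p ^ k * m) = (k + 1) * numDiagReps 1 15 (3 ^ (genus p * k) * m) := by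
  have h3 : p ≠ 3 := by rintro rfl; omega
  induction k using Nat.twoStepInduction generalizing m with
  | zero => simp
  | one => simpa using numDiagReps_split_mul hp hp2 h hm
  | more k ih1 ih2 =>
    have key := numDiagReps_split_sq_mul hp hp2 h (p ^ k * m)
    rw [show p * (3 ^ genus p * (p ^ k * m)) = p ^ (k + 1) * (3 ^ genus p * m) by ring,
      ih2 (not_dvd_three_pow_mul hp h3 hm _), ih1 hm,
      show 3 ^ (genus p * (k + 1)) * (3 ^ genus p * m) =
        3 ^ genus p * (3 ^ genus p * (3 ^ (genus p * k) * m)) by ring,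
      numDiagReps_three_pow_mul_three_pow_mul] at key
    rw [show p ^ (k + 2) * m = p ^ 2 * (p ^ k * m) by ring,
      show 3 ^ (genus p * (k + 2)) * m =
        3 ^ genus p * (3 ^ genus p * (3 ^ (genus p * k) * m)) by ring,
      numDiagReps_three_pow_mul_three_pow_mul]
    linarith

/-! ### Products of prime powers and the exponent t -/

theorem not_dvd_prod_pow {ι : Type*} {f e : ι → ℕ} (hf : ∀ i, (f i).Prime) {l : ℕ}
    (hl : l.Prime) (s : Finset ι) (h : ∀ i ∈ s, l ≠ f i) : ¬ l ∣ ∏ i ∈ s, f i ^ e i := by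
  rw [hl.prime.dvd_finsetProd_iff]
  rintro ⟨i, hi, hdvd⟩
  exact h i hi ((Nat.prime_dvd_prime_iff_eq hl (hf i)).1 (hl.dvd_of_dvd_pow hdvd))

theorem numDiagReps_prod_split_mul {ι : Type*} {p v : ι → ℕ}
    (hp : ∀ i, (p i).Prime) (hp_inj : Function.Injective p)
    (hp_class : ∀ i, p i % 15 = 1 ∨ p i % 15 = 2 ∨ p i % 15 = 4 ∨ p i % 15 = 8)
    (hp_two : ∀ i, p i ≠ 2) (s : Finset ι) {m : ℕ} (hm : ∀ i ∈ s, ¬ p i ∣ m) :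
    numDiagReps 1 15 ((∏ i ∈ s, p i ^ v i) * m) =
      (∏ i ∈ s, (1 + v i)) * numDiagReps 1 15 (3 ^ (∑ i ∈ s, genus (p i) * v i) * m) := by
  classical
  induction s using Finset.induction_on generalizing m with
  | empty => simp
  | insert i s hi ih =>
    have h3 : ∀ j, p j ≠ 3 := fun j hj => by have := hp_class j; omega
    have hndvd : ¬ p i ∣ (∏ j ∈ s, p j ^ v j) * m := by
      rw [(hp i).dvd_mul]
      rintro (h | h)
      · exact not_dvd_prod_pow hp (hp i) s
          (fun j hj hij => hi (by rwa [hp_inj hij])) h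
      · exact hm i (Finset.mem_insert_self _ _) h
    rw [Finset.prod_insert hi, Finset.prod_insert hi, Finset.sum_insert hi, mul_assoc,
      numDiagReps_split_pow_mul (hp i) (hp_two i) (hp_class i) _ hndvd, mul_left_comm (3 ^ _),
      ih fun j hj => not_dvd_three_pow_mul (hp j) (h3 j) (hm j (Finset.mem_insert_of_mem hj)) _,
      show 3 ^ (∑ i ∈ s, genus (p i) * v i) * (3 ^ (genus (p i) * v i) * m) =
        3 ^ (genus (p i) * v i + ∑ i ∈ s, genus (p i) * v i) * m by ring]
    ring

theorem numDiagReps_prod_inert_mul {ι : Type*} {q w : ι → ℕ}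
    (hq : ∀ j, (q j).Prime) (hq_inj : Function.Injective q)
    (hq_class : ∀ j, q j % 15 = 7 ∨ q j % 15 = 11 ∨ q j % 15 = 13 ∨ q j % 15 = 14)
    (s : Finset ι) {m : ℕ} (hm : ∀ i ∈ s, ¬ q i ∣ m) :
    (numDiagReps 1 15 ((∏ i ∈ s, q i ^ w i) * m) : ℚ) =
      (∏ i ∈ s, ((1 + (-1 : ℚ) ^ w i) / 2)) * numDiagReps 1 15 m := by
  classical
  induction s using Finset.induction_on with
  | empty => simp
  | insert i s hi ih =>
    have hndvd : ¬ q i ∣ (∏ j ∈ s, q j ^ w j) * m := by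
      rw [(hq i).dvd_mul]
      rintro (h | h)
      · exact not_dvd_prod_pow hq (hq i) s
          (fun j hj hij => hi (by rwa [hq_inj hij])) h
      · exact hm i (Finset.mem_insert_self _ _) h
    rw [Finset.prod_insert hi, Finset.prod_insert hi, mul_assoc,
      numDiagReps_inert_pow_mul (hq i) (hq_class i) _ hndvd,
      ih fun j hj => hm j (Finset.mem_insert_of_mem hj)]
    ring

theorem oddPrimeFactorCount_mul {m n : ℕ} (hm : m ≠ 0) (hn : n ≠ 0) :
    oddPrimeFactorCount (m * n) = oddPrimeFactorCount m + oddPrimeFactorCount n := by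
  unfold oddPrimeFactorCount
  rw [(Nat.perm_primeFactorsList_mul hm hn).countP_eq, List.countP_append]

theorem oddPrimeFactorCount_prime_pow {l : ℕ} (hl : l.Prime) (e : ℕ) :
    oddPrimeFactorCount (l ^ e) = if Odd l ∧ (l % 15 = 2 ∨ l % 15 = 8) then e else 0 := by
  unfold oddPrimeFactorCount
  rw [hl.primeFactorsList_pow, List.countP_replicate]
  simp

theorem oddPrimeFactorCount_prod {ι : Type*} {f e : ι → ℕ} (hf : ∀ i, (f i).Prime)
    (s : Finset ι) :
    oddPrimeFactorCount (∏ i ∈ s, f i ^ e i) = ∑ i ∈ s, oddPrimeFactorCount (f i ^ e i) := by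
  classical
  induction s using Finset.induction_on with
  | empty => simp [oddPrimeFactorCount]
  | insert i s hi ih =>
    rw [Finset.prod_insert hi, Finset.sum_insert hi, oddPrimeFactorCount_mul, ih]
    · exact pow_ne_zero _ (hf i).ne_zero
    · exact Finset.prod_ne_zero_iff.2 fun j _ => pow_ne_zero _ (hf j).ne_zero

/-! ### Assembly -/

/-- The number of representations by `x² + 15 y²`, with the parity of the genus kept as an
exponent of `3`. -/
theorem numDiagReps_one_fifteen_factored {ι κ : Type*} [Fintype ι] [Fintype κ]
    (a b c : ℕ) (p v : ι → ℕ) (q w : κ → ℕ)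
    (hp : ∀ i, (p i).Prime) (hp_inj : Function.Injective p)
    (hp_class : ∀ i, p i % 15 = 1 ∨ p i % 15 = 2 ∨ p i % 15 = 4 ∨ p i % 15 = 8)
    (hp_two : ∀ i, p i ≠ 2)
    (hq : ∀ j, (q j).Prime) (hq_inj : Function.Injective q)
    (hq_class : ∀ j, q j % 15 = 7 ∨ q j % 15 = 11 ∨ q j % 15 = 13 ∨ q j % 15 = 14) :
    (numDiagReps 1 15 (2 ^ a * 3 ^ b * 5 ^ c * (∏ i, p i ^ v i) * ∏ j, q j ^ w j) : ℚ) =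
      |(a : ℚ) - 1| * (1 + (-1 : ℚ) ^ (a + b + c + ∑ i, genus (p i) * v i)) *
        (∏ i, (1 + (v i : ℚ))) * ∏ j, ((1 + (-1 : ℚ) ^ w j) / 2) := by
  have hp3 : ∀ i, p i ≠ 3 := fun i hi => by have := hp_class i; omega
  have hq2 : ∀ j, q j ≠ 2 := fun j hj => by have := hq_class j; omega
  have hq3 : ∀ j, q j ≠ 3 := fun j hj => by have := hq_class j; omega
  have hodd : Odd (3 ^ b * 5 ^ c * (∏ i, p i ^ v i) * ∏ j, q j ^ w j) := by
    rw [← Nat.not_even_iff_odd, even_iff_two_dvd]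
    simp only [Nat.prime_two.dvd_mul, not_or]
    exact ⟨⟨⟨fun h => by simpa using Nat.prime_two.dvd_of_dvd_pow h,
      fun h => by simpa using Nat.prime_two.dvd_of_dvd_pow h⟩,
      not_dvd_prod_pow hp Nat.prime_two _ fun i _ => (hp_two i).symm⟩,
      not_dvd_prod_pow hq Nat.prime_two _ fun j _ => (hq2 j).symm⟩
  have h1 : 2 ^ a * 3 ^ b * 5 ^ c * (∏ i, p i ^ v i) * ∏ j, q j ^ w j =
      2 ^ a * (3 ^ b * 5 ^ c * (∏ i, p i ^ v i) * ∏ j, q j ^ w j) := by ring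
  have h2 : 3 ^ a * (3 ^ b * 5 ^ c * (∏ i, p i ^ v i) * ∏ j, q j ^ w j) =
      5 ^ c * (3 ^ (a + b) * (∏ i, p i ^ v i) * ∏ j, q j ^ w j) := by ring
  have h3 : 3 ^ c * (3 ^ (a + b) * (∏ i, p i ^ v i) * ∏ j, q j ^ w j) =
      (∏ j, q j ^ w j) * ((∏ i, p i ^ v i) * 3 ^ (a + b + c)) := by ring
  -- The powers of 2, of 5 and of the p with δ = 1 each leave a power of 3 behind, so only N of a
  -- power of 3 remains.
  rw [h1, numDiagReps_two_pow_mul a hodd, h2, numDiagReps_five_pow_mul, h3,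
    numDiagReps_prod_inert_mul hq hq_inj hq_class, numDiagReps_prod_split_mul hp hp_inj hp_class
    hp_two, ← pow_add, Nat.cast_mul, numDiagReps_three_pow, add_comm (∑ i, _)]
  · push_cast
    ring
  · intro i _ h
    exact hp3 i ((Nat.prime_dvd_prime_iff_eq (hp i) Nat.prime_three).1 ((hp i).dvd_of_dvd_pow h))
  · intro j _ h
    rcases (hq j).dvd_mul.1 h with h | h
    · refine not_dvd_prod_pow hp (hq j) _ (fun i _ hij => ?_) h
      have h4 := hp_class i
      have h5 := hq_class j
      omega
    · exact hq3 j
        ((Nat.prime_dvd_prime_iff_eq (hq j) Nat.prime_three).1 ((hq j).dvd_of_dvd_pow h))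

theorem oddPrimeFactorCount_factored {ι κ : Type*} [Fintype ι] [Fintype κ]
    (a b c : ℕ) (p v : ι → ℕ) (q w : κ → ℕ)
    (hp : ∀ i, (p i).Prime) (hp_two : ∀ i, p i ≠ 2) (hq : ∀ j, (q j).Prime)
    (hq_class : ∀ j, q j % 15 = 7 ∨ q j % 15 = 11 ∨ q j % 15 = 13 ∨ q j % 15 = 14) :
    oddPrimeFactorCount (2 ^ a * 3 ^ b * 5 ^ c * (∏ i, p i ^ v i) * ∏ j, q j ^ w j) =
      ∑ i, genus (p i) * v i := by
  have hP : ∏ i, p i ^ v i ≠ 0 :=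
    Finset.prod_ne_zero_iff.2 fun i _ => pow_ne_zero _ (hp i).ne_zero
  have hQ : ∏ j, q j ^ w j ≠ 0 :=
    Finset.prod_ne_zero_iff.2 fun j _ => pow_ne_zero _ (hq j).ne_zero
  have hq0 : ∑ j, oddPrimeFactorCount (q j ^ w j) = 0 := by
    refine Finset.sum_eq_zero fun j _ => ?_
    rw [oddPrimeFactorCount_prime_pow (hq j), if_neg]
    rintro ⟨-, h⟩
    have := hq_class j
    omega
  rw [oddPrimeFactorCount_mul (by positivity) hQ, oddPrimeFactorCount_mul (by positivity) hP,
    oddPrimeFactorCount_mul (by positivity) (by positivity),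
    oddPrimeFactorCount_mul (by positivity) (by positivity), oddPrimeFactorCount_prod hp,
    oddPrimeFactorCount_prod hq, hq0, oddPrimeFactorCount_prime_pow Nat.prime_two,
    oddPrimeFactorCount_prime_pow Nat.prime_three, oddPrimeFactorCount_prime_pow Nat.prime_five,
    if_neg (by decide), if_neg (by decide), if_neg (by decide)]
  simp only [zero_add, add_zero]
  refine Finset.sum_congr rfl fun i _ => ?_
  rw [oddPrimeFactorCount_prime_pow (hp i)]
  simp [(hp i).odd_of_ne_two (hp_two i), genus]

theorem corollary5p2
    (n a b c r s : ℕ) (p v : Fin r → ℕ) (q w : Fin s → ℕ)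
    (hp : ∀ i, (p i).Prime) (hp_inj : Function.Injective p)
    (hp_class : ∀ i, p i % 15 = 1 ∨ p i % 15 = 2 ∨ p i % 15 = 4 ∨ p i % 15 = 8)
    (hp_two : ∀ i, p i ≠ 2)
    (hq : ∀ j, (q j).Prime) (hq_inj : Function.Injective q)
    (hq_class : ∀ j, q j % 15 = 7 ∨ q j % 15 = 11 ∨ q j % 15 = 13 ∨ q j % 15 = 14)
    (hn : n = 2 ^ a * 3 ^ b * 5 ^ c * (∏ i, p i ^ v i) * ∏ j, q j ^ w j) :
    (numDiagReps 1 15 n : ℚ) =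
        |(a : ℚ) - 1| * (1 + (-1 : ℚ) ^ (a + b + c + oddPrimeFactorCount n)) *
          (∏ i, (1 + (v i : ℚ))) * ∏ j, ((1 + (-1 : ℚ) ^ w j) / 2) ∧
      (numDiagReps 3 5 n : ℚ) =
        |(a : ℚ) - 1| * (1 - (-1 : ℚ) ^ (a + b + c + oddPrimeFactorCount n)) *
          (∏ i, (1 + (v i : ℚ))) * ∏ j, ((1 + (-1 : ℚ) ^ w j) / 2) := by
  have hcount := oddPrimeFactorCount_factored a b c p v q w hp hp_two hq hq_class
  rw [← hn] at hcount
  rw [hcount, numDiagReps_three_five]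
  refine ⟨?_, ?_⟩
  · rw [hn]
    exact numDiagReps_one_fifteen_factored a b c p v q w hp hp_inj hp_class hp_two hq hq_inj
      hq_class
  -- Raising b by one flips the sign, which is the only difference between the two formulas.
  · have h3 : 3 * n = 2 ^ a * 3 ^ (b + 1) * 5 ^ c * (∏ i, p i ^ v i) * ∏ j, q j ^ w j := by
      rw [hn]; ring
    rw [h3, numDiagReps_one_fifteen_factored a (b + 1) c p v q w hp hp_inj hp_class hp_two hq
      hq_inj hq_class,
      show a + (b + 1) + c + ∑ i, genus (p i) * v i = a + b + c + ∑ i, genus (p i) * v i + 1 by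
        ring, pow_succ (-1 : ℚ) (a + b + c + _)]
    ring
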